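/- Infinite words are indexed by $\mathbb N$ over $A=\{0,1\}$. An infinite word is Sturmian if it has exactly $n+1$ distinct factors of each length $n\ge 0$; its language is its set of factors. A Sturmian word $\mathbf c$ is characteristic if $0p$ and $1p$ are factors of $\mathbf c$ for every prefix $p$ of $\mathbf c$. For rational $\alpha$ with $0\le\alpha<1$, the lower (resp. upper) Christoffel word of slope $\alpha$ is the shortest nonempty word $v$ such that $v^\omega$ is the infinite word whose $n$-th letter ($n\ge 0$) is $0$ if $\{n\alpha\}<1-\alpha$ (resp. if $0<\{n\alpha\}\le 1-\alpha$) and $1$ otherwise, where $\{\cdot\}$ is the fractional part. A Christoffel word is a lower or upper Christoffel word. Write $\tilde v$ for the reversal of a word $v$. A reversible Christoffel (RC) factorization of a Sturmian word $\mathbf w$ is an infinite sequence $(x_k)_{k>0}$ of Christoffel words such that $\mathbf w=x_1x_2\cdots$ and $\mathbf w':=\tilde x_1\tilde x_2\cdots$ is a Sturmian word; it is then said to be determined by $\mathbf w'$. **Proposition.** Every Sturmian word $\mathbf w$ admits uncountably many distinct RC factorizations. Moreover, for every Sturmian word $\mathbf w'$ with the same language as $\mathbf w$ and such that $\{\mathbf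 w,\mathbf w'\}\ne\{0\mathbf c,1\mathbf c\}$, where $\mathbf c$ is the characteristic Sturmian word with that language, there is exactly one RC factorization of $\mathbf w$ determined by $\mathbf w'$; and RC factorizations of $\mathbf w$ determined by distinct words are distinct. -/

import Mathlib

/-! Infinite words over `{0,1}` are functions `ℕ → Fin 2` (the first letter has index `0`);
finite words are lists. -/

namespace Sturm

/-- The factor of length `n` of the infinite word `w` that starts at position `i`. -/
def factorAt (w : ℕ → Fin 2) (i n : ℕ) : List (Fin 2) :=
  (List.range n).map fun j => w (i + j)

/-- The set of factors of length `n` of `w`. -/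
def factorsOfLength (w : ℕ → Fin 2) (n : ℕ) : Set (List (Fin 2)) :=
  Set.range fun i => factorAt w i n

/-- The language (set of all factors) of `w`. -/
def language (w : ℕ → Fin 2) : Set (List (Fin 2)) :=
  {u | ∃ i n, u = factorAt w i n}

/-- `w` is Sturmian: it has exactly `n + 1` distinct factors of each length `n`. -/
def IsSturmian (w : ℕ → Fin 2) : Prop :=
  ∀ n, (factorsOfLength w n).ncard = n + 1

/-- The infinite word `a w`. -/
def cons (a : Fin 2) (w : ℕ → Fin 2) : ℕ → Fin 2
  | 0 => a
  | n + 1 => w n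

/-- `c` is a characteristic (standard) Sturmian word: `c` is Sturmian and each of its prefixes is
left special, that is, can be preceded by both letters inside the language of `c`. -/
def IsCharacteristic (c : ℕ → Fin 2) : Prop :=
  IsSturmian c ∧ ∀ n, ∀ a : Fin 2, a :: factorAt c 0 n ∈ language c

open Classical in
/-- The lower mechanical word of slope `α` and intercept `ρ`. -/
noncomputable def lowerMechanical (α ρ : ℝ) : ℕ → Fin 2 := fun n =>
  if Int.fract ((n : ℝ) * α + ρ) < 1 - α then 0 else 1

open Classical in
/-- The upper mechanical word of slope `α` and intercept `ρ`. -/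
noncomputable def upperMechanical (α ρ : ℝ) : ℕ → Fin 2 := fun n =>
  if 0 < Int.fract ((n : ℝ) * α + ρ) ∧ Int.fract ((n : ℝ) * α + ρ) ≤ 1 - α then 0 else 1

/-- `w = v v v ⋯` with `v` nonempty. -/
def IsOmegaPower (w : ℕ → Fin 2) (v : List (Fin 2)) : Prop :=
  v ≠ [] ∧ ∀ n, v[n % v.length]? = some (w n)

/-- `v` is the shortest (nonempty) word with `w = v v v ⋯`. -/
def IsShortestPeriodWord (w : ℕ → Fin 2) (v : List (Fin 2)) : Prop :=
  IsOmegaPower w v ∧ ∀ u, IsOmegaPower w u → v.length ≤ u.length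

/-- `v` is the lower Christoffel word of some rational slope `α`, `0 ≤ α < 1`. -/
def IsLowerChristoffel (v : List (Fin 2)) : Prop :=
  ∃ α : ℚ, 0 ≤ α ∧ α < 1 ∧ IsShortestPeriodWord (lowerMechanical α 0) v

/-- `v` is the upper Christoffel word of some rational slope `α`, `0 ≤ α < 1`. With the above
convention for mechanical words, slope `0` gives the letter `1` here, and `0` in the lower case. -/
def IsUpperChristoffel (v : List (Fin 2)) : Prop :=
  ∃ α : ℚ, 0 ≤ α ∧ α < 1 ∧ IsShortestPeriodWord (upperMechanical α 0) v

/-- Christoffel words, lower or upper. -/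
def IsChristoffel (v : List (Fin 2)) : Prop :=
  IsLowerChristoffel v ∨ IsUpperChristoffel v

/-- The finite product `x 0 ⬝ x 1 ⬝ ⋯ ⬝ x (k - 1)`. -/
def partialProduct (x : ℕ → List (Fin 2)) (k : ℕ) : List (Fin 2) :=
  ((List.range k).map x).flatten

/-- `w` is the infinite product `x 0 ⬝ x 1 ⬝ x 2 ⬝ ⋯`: all partial products are prefixes of `w`,
and their lengths are unbounded. -/
def IsInfiniteProduct (w : ℕ → Fin 2) (x : ℕ → List (Fin 2)) : Prop :=
  (∀ k, partialProduct x k = factorAt w 0 (partialProduct x k).length) ∧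
    ∀ n, ∃ k, n ≤ (partialProduct x k).length

/-- The sequence `x` is a reversible Christoffel (RC) factorization of `w`
determined by the Sturmian word `w'`. -/
def IsRCDeterminedBy (w w' : ℕ → Fin 2) (x : ℕ → List (Fin 2)) : Prop :=
  (∀ k, IsChristoffel (x k)) ∧ IsInfiniteProduct w x ∧
    IsSturmian w' ∧ IsInfiniteProduct w' (fun k => (x k).reverse)

/-- The sequence `x` is a reversible Christoffel (RC) factorization of `w`. -/
def IsRCFactorization (w : ℕ → Fin 2) (x : ℕ → List (Fin 2)) : Prop :=
  ∃ w', IsRCDeterminedBy w w' x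

end Sturm

namespace Sturm

/-! ### Factors -/

/-! Read `w` and `w'` in parallel, cutting where their prefixes contain equally many letters `1`. At
a cut, equal letters form a block of length one. If the letters are `0` and `1`, then `w'` is one
ahead in `1`s until the next disagreement. Sturmian languages are balanced (`IsSturmian.height_le`),
so `w'` cannot get two ahead and that disagreement is `1` against `0`. The two blocks are then `0p1`
and `1p0`, and balance makes them the lower and upper Christoffel words of one slope, which are
mirror images (`exists_letters_of_isSturmian`). The prefixes are level again and the cutting
continues.

The next disagreement can be missing only at the very start, which is the excluded pair `0c`, `1c`;
at a later cut its absence would make `w` eventually periodic (`exists_ne_after`).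

Uniqueness: a Christoffel word of length at least two differs from its reversal exactly at its two
ends, so `w` and `w'` dictate every cut (`IsBlock.eq`). A factorization also determines `w'` as the
product of its reversed terms. Uncountability follows, because uncountably many words have their
language inside that of `w`, and all but countably many of them are admissible choices of `w'`. -/

theorem factorAt_eq_iff {w w' : ℕ → Fin 2} {i j n : ℕ} :
    factorAt w i n = factorAt w' j n ↔ ∀ k < n, w (i + k) = w' (j + k) := by
  simp [factorAt, List.map_inj_left]

@[simp] theorem length_factorAt (w : ℕ → Fin 2) (i n : ℕ) : (factorAt w i n).length = n := by
  simp [factorAt]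

@[simp] theorem getElem_factorAt (w : ℕ → Fin 2) (i n k : ℕ) (h : k < (factorAt w i n).length) :
    (factorAt w i n)[k] = w (i + k) := by
  simp [factorAt]

theorem factorAt_succ (w : ℕ → Fin 2) (i n : ℕ) :
    factorAt w i (n + 1) = factorAt w i n ++ [w (i + n)] := by
  simp [factorAt, List.range_succ]

theorem factorAt_add (w : ℕ → Fin 2) (i m n : ℕ) :
    factorAt w i (m + n) = factorAt w i m ++ factorAt w (i + m) n := by
  simp [factorAt, List.range_add, Function.comp_def, Nat.add_assoc]

theorem finite_factorsOfLength (w : ℕ → Fin 2) (n : ℕ) : (factorsOfLength w n).Finite :=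
  (List.finite_length_eq (Fin 2) n).subset (by rintro _ ⟨i, rfl⟩; simp)

theorem mem_factorsOfLength_iff {w : ℕ → Fin 2} {n : ℕ} {u : List (Fin 2)} :
    u ∈ factorsOfLength w n ↔ u ∈ language w ∧ u.length = n := by
  constructor
  · rintro ⟨i, rfl⟩
    exact ⟨⟨i, n, rfl⟩, by simp⟩
  · rintro ⟨⟨i, m, rfl⟩, h⟩
    rw [length_factorAt] at h
    exact ⟨i, by rw [h]⟩

theorem exists_factorAt_eq {w w' : ℕ → Fin 2} (h : language w' ⊆ language w) (i n : ℕ) :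
    ∃ j, factorAt w j n = factorAt w' i n := by
  have : factorAt w' i n ∈ factorsOfLength w n :=
    mem_factorsOfLength_iff.2 ⟨h ⟨i, n, rfl⟩, by simp⟩
  exact this

/-- Eventual periodicity of an infinite word. -/
def EventuallyPeriodic (w : ℕ → Fin 2) : Prop :=
  ∃ N d, 0 < d ∧ ∀ i, N ≤ i → w (i + d) = w i

theorem IsSturmian.not_eventuallyPeriodic {w : ℕ → Fin 2} (hw : IsSturmian w) :
    ¬ EventuallyPeriodic w := by
  rintro ⟨N, d, hd, h⟩
  have hsub : factorsOfLength w (N + d) ⊆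
      (fun i => factorAt w i (N + d)) '' (Set.Iio (N + d)) := by
    rintro _ ⟨i, rfl⟩
    induction i using Nat.strong_induction_on with
    | _ i ih =>
      by_cases hi : i < N + d
      · exact ⟨i, hi, rfl⟩
      · have e : factorAt w i (N + d) = factorAt w (i - d) (N + d) := by
          rw [factorAt_eq_iff]
          intro k _
          rw [← h (i - d + k) (by omega)]
          congr 1
          omega
        simp only [e]
        exact ih (i - d) (by omega)
  have h1 := Set.ncard_le_ncard hsub ((Set.finite_Iio _).image _)
  have h2 := Set.ncard_image_le (f := fun i => factorAt w i (N + d)) (Set.finite_Iio (N + d))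
  rw [hw] at h1
  have h3 : (Set.Iio (N + d)).ncard = N + d := by simp [Set.ncard_eq_toFinset_card']
  omega

/-- The factor of length `n` at position `i` is always followed by the same letter. -/
def FollowedUniquely (w : ℕ → Fin 2) (n i : ℕ) : Prop :=
  ∀ j, factorAt w j n = factorAt w i n → w (j + n) = w (i + n)

theorem factorAt_step {w : ℕ → Fin 2} {n i j : ℕ} (h : factorAt w i n = factorAt w j n)
    (h' : w (i + n) = w (j + n)) : factorAt w (i + 1) n = factorAt w (j + 1) n := by
  rw [factorAt_eq_iff] at *
  intro k hk
  rcases Nat.lt_or_ge (k + 1) n with h1 | h1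
  · have := h (k + 1) h1
    rwa [show i + 1 + k = i + (k + 1) by omega, show j + 1 + k = j + (k + 1) by omega]
  · rwa [show i + 1 + k = i + n by omega, show j + 1 + k = j + n by omega]

/-- Between two occurrences of the same window every next letter is forced, so the second occurrence
replays the path from the first for ever. -/
theorem eventuallyPeriodic_of_repeat {w : ℕ → Fin 2} {n i j : ℕ} (hij : i < j)
    (h : factorAt w i n = factorAt w j n)
    (hu : ∀ k, i ≤ k → k < j → FollowedUniquely w n k) : EventuallyPeriodic w := by
  have key : ∀ t, factorAt w (i + t) n = factorAt w (j + t) n ∧ FollowedUniquely w n (i + t) := by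
    intro t
    induction t using Nat.strong_induction_on with
    | _ t ih =>
      constructor
      · rcases t with _ | t
        · exact h
        · obtain ⟨h1, h2⟩ := ih t (by omega)
          exact factorAt_step h1 (h2 _ h1.symm).symm
      · by_cases ht : i + t < j
        · exact hu _ (by omega) ht
        · obtain ⟨h1, h2⟩ := ih (t - (j - i)) (by omega)
          rw [show j + (t - (j - i)) = i + t by omega] at h1
          intro m hm
          rw [h2 m (hm.trans h1.symm), h2 (i + t) h1.symm]
  refine ⟨i + n, j - i, by omega, fun m hm => ?_⟩
  obtain ⟨h1, h2⟩ := key (m - (i + n))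
  have := h2 _ h1.symm
  rwa [show j + (m - (i + n)) + n = m + (j - i) by omega,
    show i + (m - (i + n)) + n = m by omega] at this

/-- The right special factors of length `n`. -/
def rightSpecial (w : ℕ → Fin 2) (n : ℕ) : Set (List (Fin 2)) :=
  {u | ∀ a : Fin 2, u ++ [a] ∈ factorsOfLength w (n + 1)}

/-- Inclusion–exclusion for the sets `E a` of words that can be followed by `a`: their union is all
factors, their intersection the right special ones. -/
theorem ncard_factorsOfLength_succ (w : ℕ → Fin 2) (n : ℕ) :
    (factorsOfLength w (n + 1)).ncard = (factorsOfLength w n).ncard + (rightSpecial w n).ncard := by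
  set E : Fin 2 → Set (List (Fin 2)) := fun a => {u | u ++ [a] ∈ factorsOfLength w (n + 1)} with hE
  have hsub : ∀ a, E a ⊆ factorsOfLength w n := by
    rintro a u ⟨i, hi⟩
    simp only [factorAt_succ] at hi
    exact ⟨i, (List.append_inj' hi rfl).1⟩
  have hfin : ∀ a, (E a).Finite := fun a => (finite_factorsOfLength w n).subset (hsub a)
  have h1 : factorsOfLength w n = E 0 ∪ E 1 := by
    apply Set.Subset.antisymm
    · rintro _ ⟨i, rfl⟩
      have hm : factorAt w i n ∈ E (w (i + n)) := ⟨i, factorAt_succ w i n⟩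
      rcases Fin.exists_fin_two.1 ⟨w (i + n), rfl⟩ with h | h
      · exact Or.inl (by rwa [← h])
      · exact Or.inr (by rwa [← h])
    · exact Set.union_subset (hsub 0) (hsub 1)
  have h2 : rightSpecial w n = E 0 ∩ E 1 := by
    ext u
    simp [rightSpecial, hE, Fin.forall_fin_two]
  have h3 : factorsOfLength w (n + 1) = (· ++ [0]) '' E 0 ∪ (· ++ [1]) '' E 1 := by
    apply Set.Subset.antisymm
    · rintro _ ⟨i, rfl⟩
      have hm : factorAt w i n ∈ E (w (i + n)) := ⟨i, factorAt_succ w i n⟩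
      simp only [factorAt_succ]
      rcases Fin.exists_fin_two.1 ⟨w (i + n), rfl⟩ with h | h
      · exact Or.inl ⟨_, h ▸ hm, by simp [h]⟩
      · exact Or.inr ⟨_, h ▸ hm, by simp [h]⟩
    · rintro _ (⟨u, hu, rfl⟩ | ⟨u, hu, rfl⟩) <;> exact hu
  have hinj : ∀ a : Fin 2, Function.Injective (fun u : List (Fin 2) => u ++ [a]) :=
    fun a u v h => (List.append_inj' h rfl).1
  rw [h1, h2, Set.ncard_union_add_ncard_inter _ _ (hfin 0) (hfin 1), h3,
    Set.ncard_union_eq _ ((hfin 0).image _) ((hfin 1).image _),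
    Set.ncard_image_of_injective _ (hinj 0), Set.ncard_image_of_injective _ (hinj 1)]
  rw [Set.disjoint_left]
  rintro _ ⟨u, _, rfl⟩ ⟨v, _, h⟩
  simpa using (List.append_inj' h rfl).2

theorem finite_rightSpecial (w : ℕ → Fin 2) (n : ℕ) : (rightSpecial w n).Finite := by
  refine (finite_factorsOfLength w n).subset fun u hu => ?_
  obtain ⟨i, hi⟩ := hu 0
  simp only [factorAt_succ] at hi
  exact ⟨i, (List.append_inj' hi rfl).1⟩

theorem factorAt_mem_rightSpecial {w : ℕ → Fin 2} {n i j : ℕ}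
    (h : factorAt w j n = factorAt w i n) (h' : w (j + n) ≠ w (i + n)) :
    factorAt w i n ∈ rightSpecial w n := by
  intro a
  by_cases ha : a = w (i + n)
  · exact ⟨i, by rw [ha]; exact factorAt_succ w i n⟩
  · refine ⟨j, ?_⟩
    simp only [factorAt_succ]
    rw [h]
    congr 2
    omega

theorem followedUniquely_of_not_mem {w : ℕ → Fin 2} {n i : ℕ}
    (h : factorAt w i n ∉ rightSpecial w n) : FollowedUniquely w n i := by
  intro j hj
  by_contra h'
  exact h (factorAt_mem_rightSpecial hj h')

/-- The Morse–Hedlund bound. -/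
theorem lt_ncard_factorsOfLength {w : ℕ → Fin 2} (hw : ¬ EventuallyPeriodic w) (n : ℕ) :
    n + 1 ≤ (factorsOfLength w n).ncard := by
  induction n with
  | zero =>
    rw [Nat.succ_le_iff, Set.ncard_pos (finite_factorsOfLength w 0)]
    exact ⟨_, 0, rfl⟩
  | succ n ih =>
    rw [ncard_factorsOfLength_succ]
    suffices 0 < (rightSpecial w n).ncard by omega
    rw [Set.ncard_pos (finite_rightSpecial w n)]
    by_contra hne
    rw [Set.not_nonempty_iff_eq_empty] at hne
    obtain ⟨i, -, j, -, hij, h⟩ := Set.infinite_univ.exists_lt_map_eq_of_mapsTo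
      (f := fun i => factorAt w i n) (t := factorsOfLength w n)
      (fun i _ => ⟨i, rfl⟩) (finite_factorsOfLength w n)
    exact hw (eventuallyPeriodic_of_repeat hij h
      fun k _ _ => followedUniquely_of_not_mem (by simp [hne]))

/-- The Morse–Hedlund lower bound for `w'` meets the Sturmian count for `w`, so the inclusion is an
equality in each length. -/
theorem isSturmian_of_language_subset {w w' : ℕ → Fin 2} (hw : IsSturmian w)
    (hw' : ¬ EventuallyPeriodic w') (h : language w' ⊆ language w) :
    IsSturmian w' ∧ language w' = language w := by
  have heq : ∀ n, factorsOfLength w' n = factorsOfLength w n := by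
    intro n
    refine Set.eq_of_subset_of_ncard_le ?_ ?_ (finite_factorsOfLength w n)
    · intro u hu
      rw [mem_factorsOfLength_iff] at *
      exact ⟨h hu.1, hu.2⟩
    · rw [hw]
      exact lt_ncard_factorsOfLength hw' n
  refine ⟨fun n => by rw [heq, hw], h.antisymm fun u hu => ?_⟩
  have : u ∈ factorsOfLength w' u.length := by
    rw [heq]
    exact mem_factorsOfLength_iff.2 ⟨hu, rfl⟩
  exact (mem_factorsOfLength_iff.1 this).1

theorem isSturmian_tail {w : ℕ → Fin 2} (hw : IsSturmian w) (N : ℕ) :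
    IsSturmian (fun i => w (N + i)) ∧ language (fun i => w (N + i)) = language w := by
  apply isSturmian_of_language_subset hw
  · rintro ⟨M, d, hd, h⟩
    refine hw.not_eventuallyPeriodic ⟨N + M, d, hd, fun i hi => ?_⟩
    have := h (i - N) (by omega)
    simp only at this
    rwa [show N + (i - N + d) = i + d by omega, show N + (i - N) = i by omega] at this
  · rintro _ ⟨i, n, rfl⟩
    refine ⟨N + i, n, ?_⟩
    rw [factorAt_eq_iff]
    intro k _
    simp only [Nat.add_assoc]

theorem IsSturmian.recurrent {w : ℕ → Fin 2} (hw : IsSturmian w) (i n N : ℕ) :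
    ∃ j, N ≤ j ∧ factorAt w j n = factorAt w i n := by
  obtain ⟨j, hj⟩ := exists_factorAt_eq (isSturmian_tail hw N).2.ge i n
  refine ⟨N + j, by omega, ?_⟩
  rw [← hj, factorAt_eq_iff]
  intro k _
  simp only [Nat.add_assoc]

/-! ### Balance -/

/-- The number of letters `1` in the factor of length `n` at position `i`. -/
def height (w : ℕ → Fin 2) (i n : ℕ) : ℤ := ∑ k ∈ Finset.range n, ((w (i + k)).val : ℤ)

@[simp] theorem height_zero (w : ℕ → Fin 2) (i : ℕ) : height w i 0 = 0 := by simp [height]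

theorem height_succ (w : ℕ → Fin 2) (i n : ℕ) :
    height w i (n + 1) = height w i n + (w (i + n)).val := by
  simp [height, Finset.sum_range_succ]

theorem height_add (w : ℕ → Fin 2) (i m n : ℕ) :
    height w i (m + n) = height w i m + height w (i + m) n := by
  simp [height, Finset.sum_range_add, Nat.add_assoc]

theorem height_congr {w w' : ℕ → Fin 2} {i j n : ℕ} (h : factorAt w i n = factorAt w' j n) :
    height w i n = height w' j n := by
  rw [factorAt_eq_iff] at h
  exact Finset.sum_congr rfl fun k hk => by rw [h k (Finset.mem_range.1 hk)]

theorem factorAt_ne_of_ne {w : ℕ → Fin 2} {i j n k : ℕ} (hk : k < n)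
    (h : w (i + k) ≠ w (j + k)) : factorAt w i n ≠ factorAt w j n :=
  fun e => h (factorAt_eq_iff.1 e k hk)

theorem IsSturmian.eq_of_mem_rightSpecial {w : ℕ → Fin 2} (hw : IsSturmian w) {n : ℕ}
    {u v : List (Fin 2)} (hu : u ∈ rightSpecial w n) (hv : v ∈ rightSpecial w n) : u = v := by
  have h := ncard_factorsOfLength_succ w n
  rw [hw, hw] at h
  obtain ⟨x, hx⟩ := Set.ncard_eq_one.1 (show (rightSpecial w n).ncard = 1 by omega)
  rw [hx] at hu hv
  exact hu.trans hv.symm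

/-- Here `xpx` occurs at `e` and `ypy` at `o`, with `p` a palindrome of length `N` and `x ≠ y`; the
claim is that `xp` is right special. Applied both ways, it yields two right special factors of one
length, which is what contradicts a failure of balance. -/
theorem IsSturmian.mem_rightSpecial_of_palindrome {w : ℕ → Fin 2} (hw : IsSturmian w) {N e o : ℕ}
    (hmid : ∀ k, 0 < k → k ≤ N → w (e + k) = w (o + k)) (hfst : w e ≠ w o)
    (hlst : w (e + (N + 1)) ≠ w (o + (N + 1)))
    (hpal : ∀ k, k ≤ N + 1 → w (e + k) = w (e + (N + 1 - k))) :
    factorAt w e (N + 1) ∈ rightSpecial w (N + 1) := by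
  by_contra hns
  have hp : factorAt w (e + 1) N ∈ rightSpecial w N := by
    apply factorAt_mem_rightSpecial (j := o + 1)
    · rw [factorAt_eq_iff]
      intro k hk
      rw [Nat.add_assoc, Nat.add_assoc, hmid (1 + k) (by omega) (by omega)]
    · rw [Nat.add_assoc, Nat.add_assoc, Nat.add_comm 1 N]
      exact hlst.symm
  -- If `yp` began inside `xpx` at offset `s`, the palindrome would equate the final `x` with the
  -- letter `y` at offset `s`.
  have havoid : ∀ s, s ≤ N + 1 → factorAt w (e + s) (N + 1) ≠ factorAt w o (N + 1) := by
    intro s hs h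
    rw [factorAt_eq_iff] at h
    have h0 := h 0 (by omega)
    simp only [Nat.add_zero] at h0
    rcases Nat.eq_zero_or_pos s with rfl | hpos
    · exact hfst h0
    have hend := hpal 0 (by omega)
    simp only [Nat.add_zero, Nat.sub_zero] at hend
    rcases Nat.lt_or_ge N s with h1 | h1
    · obtain rfl : s = N + 1 := by omega
      exact hfst (hend.trans h0)
    · have h2 := h (N + 1 - s) (by omega)
      rw [show e + s + (N + 1 - s) = e + (N + 1) by omega, ← hmid _ (by omega) (by omega),
        ← hpal s (by omega), h0, ← hend] at h2
      exact hfst h2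
  -- A right special window has the unique right special suffix `p`, so it is `xp` or `yp`; the
  -- assumption excludes the first and `havoid` the second.
  have hunique : ∀ s, s ≤ N + 1 → FollowedUniquely w (N + 1) (e + s) := by
    intro s hs
    apply followedUniquely_of_not_mem
    intro hrs
    have hsuf : factorAt w (e + s + 1) N ∈ rightSpecial w N := by
      intro a
      obtain ⟨m, hm⟩ := hrs a
      refine ⟨m + 1, ?_⟩
      simp only [Nat.add_comm N 1] at hm
      rw [Nat.add_comm 1 N, Nat.add_comm N 1, factorAt_add w (e + s) 1 N,
        Nat.add_comm 1 N, show N + 1 + 1 = 1 + (N + 1) by omega, factorAt_add] at hm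
      rw [List.append_assoc] at hm
      exact (List.append_inj hm (by simp)).2
    have heq := factorAt_eq_iff.1 (hw.eq_of_mem_rightSpecial hsuf hp)
    have hext : ∀ m, w m = w (e + s) → (∀ k, 0 < k → k ≤ N → w (m + k) = w (e + k)) →
        factorAt w (e + s) (N + 1) = factorAt w m (N + 1) := by
      intro m hm hk
      rw [factorAt_eq_iff]
      intro k hkN
      rcases Nat.eq_zero_or_pos k with rfl | hpos
      · exact hm.symm
      · rw [hk k hpos (by omega)]
        have := heq (k - 1) (by omega)
        rwa [show e + s + 1 + (k - 1) = e + s + k by omega,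
          show e + 1 + (k - 1) = e + k by omega] at this
    by_cases hl : w (e + s) = w e
    · rw [hext e hl.symm fun _ _ _ => rfl] at hrs
      exact hns hrs
    · exact havoid s hs (hext o (by omega) fun k h1 h2 => (hmid k h1 h2).symm)
  -- Pigeonhole: `N + 2` windows take at most `N + 1` values once `yp` is removed.
  have hmaps : Set.MapsTo (fun s => factorAt w (e + s) (N + 1)) (Set.Iic (N + 1))
      (factorsOfLength w (N + 1) \ {factorAt w o (N + 1)}) :=
    fun s hs => ⟨⟨e + s, rfl⟩, havoid s hs⟩
  have hcard : (factorsOfLength w (N + 1) \ {factorAt w o (N + 1)}).ncard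
      < (Set.Iic (N + 1)).ncard := by
    have h1 := Set.ncard_sdiff_singleton_add_one
      (show factorAt w o (N + 1) ∈ factorsOfLength w (N + 1) from ⟨o, rfl⟩)
      (finite_factorsOfLength w (N + 1))
    rw [hw] at h1
    have h3 : (Set.Iic (N + 1)).ncard = N + 2 := by simp [Set.ncard_eq_toFinset_card']
    omega
  obtain ⟨s, hs, t, ht, hst, heq⟩ := Set.exists_ne_map_eq_of_ncard_lt_of_maps_to hcard hmaps
    ((finite_factorsOfLength w (N + 1)).subset Set.sdiff_subset)
  simp only [Set.mem_Iic] at hs ht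
  rcases Nat.lt_or_gt_of_ne hst with h | h
  · refine hw.not_eventuallyPeriodic (eventuallyPeriodic_of_repeat (i := e + s) (j := e + t)
      (by omega) heq fun k h1 h2 => ?_)
    have := hunique (k - e) (by omega)
    rwa [show e + (k - e) = k by omega] at this
  · refine hw.not_eventuallyPeriodic (eventuallyPeriodic_of_repeat (i := e + t) (j := e + s)
      (by omega) heq.symm fun k h1 h2 => ?_)
    have := hunique (k - e) (by omega)
    rwa [show e + (k - e) = k by omega] at this

theorem IsSturmian.height_le {w : ℕ → Fin 2} (hw : IsSturmian w) (n i j : ℕ) :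
    height w i n ≤ height w j n + 1 := by
  induction n using Nat.strong_induction_on generalizing i j with
  | _ n ih =>
    by_contra hlt
    have hsplit : ∀ k ≤ n, ∀ i, height w i n = height w i k + height w (i + k) (n - k) := by
      intro k hk i
      rw [← height_add, Nat.add_sub_cancel' hk]
    have hn : 2 ≤ n := by
      by_contra hn
      obtain rfl | rfl : n = 0 ∨ n = 1 := by omega
      · simp at hlt
      · simp only [height, Finset.sum_range_one, Nat.add_zero] at hlt
        omega
    -- In a shortest violation the excess of at least two is split between a proper prefix and the
    -- remaining suffix, each allowed at most one.
    have hone : ∀ k, 0 < k → k < n → height w i k = height w j k + 1 := by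
      intro k h1 h2
      have := hsplit k h2.le i
      have := hsplit k h2.le j
      have := ih k h2 i j
      have := ih (n - k) (by omega) (i + k) (j + k)
      omega
    have htwo : height w i n = height w j n + 2 := by
      have := hsplit 1 (by omega) i
      have := hsplit 1 (by omega) j
      have := hone 1 (by omega) (by omega)
      have := ih (n - 1) (by omega) (i + 1) (j + 1)
      omega
    -- Comparing suffixes with prefixes of the same length; this makes the common middle a
    -- palindrome.
    have hsym : ∀ k, 0 < k → k < n → height w j k + height w j (n - k) = height w j n := by
      intro k h1 h2
      have := hsplit (n - k) (by omega) i
      have := hsplit (n - k) (by omega) j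
      rw [show n - (n - k) = k by omega] at *
      have := hone k h1 h2
      have := hone (n - k) (by omega) (by omega)
      have := ih k h2 (i + (n - k)) j
      have := ih k h2 i (j + (n - k))
      omega
    obtain ⟨N, rfl⟩ : ∃ N, n = N + 2 := ⟨n - 2, by omega⟩
    have hlast : ∀ i, height w i (N + 2) = height w i (N + 1) + (w (i + (N + 1))).val :=
      fun i => height_succ w i (N + 1)
    have hfirst : ∀ i, height w i 1 = (w i).val := by
      intro i
      simp [height]
    have hi0 : (w i).val = (w j).val + 1 := by
      have := hone 1 (by omega) (by omega)
      rw [hfirst, hfirst] at this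
      omega
    have hiN : (w (i + (N + 1))).val = (w (j + (N + 1))).val + 1 := by
      have := hone (N + 1) (by omega) (by omega)
      have := hlast i
      have := hlast j
      omega
    have hmid : ∀ k, 0 < k → k ≤ N → w (i + k) = w (j + k) := by
      intro k h1 h2
      have := hone k h1 (by omega)
      have := hone (k + 1) (by omega) (by omega)
      have := height_succ w i k
      have := height_succ w j k
      omega
    have hpalj : ∀ k, k ≤ N + 1 → w (j + k) = w (j + (N + 1 - k)) := by
      intro k hk
      rcases Nat.eq_zero_or_pos k with rfl | h1
      · simp only [Nat.add_zero, Nat.sub_zero]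
        omega
      rcases Nat.lt_or_ge N k with h2 | h2
      · obtain rfl : k = N + 1 := by omega
        simp only [Nat.sub_self, Nat.add_zero]
        omega
      have := hsym k h1 (by omega)
      have := hsym (k + 1) (by omega) (by omega)
      have := height_succ w j k
      have := height_succ w j (N + 1 - k)
      rw [show N + 2 - (k + 1) = N + 1 - k by omega] at *
      rw [show N + 2 - k = N + 1 - k + 1 by omega] at *
      omega
    have hpali : ∀ k, k ≤ N + 1 → w (i + k) = w (i + (N + 1 - k)) := by
      intro k hk
      rcases Nat.eq_zero_or_pos k with rfl | h1
      · simp only [Nat.add_zero, Nat.sub_zero]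
        omega
      rcases Nat.lt_or_ge N k with h2 | h2
      · obtain rfl : k = N + 1 := by omega
        simp only [Nat.sub_self, Nat.add_zero]
        omega
      rw [hmid k h1 h2, hpalj k hk, hmid _ (by omega) (by omega)]
    have hne0 : w i ≠ w j := by omega
    have hneN : w (i + (N + 1)) ≠ w (j + (N + 1)) := by omega
    have h1 := hw.mem_rightSpecial_of_palindrome hmid hne0 hneN hpali
    have h2 := hw.mem_rightSpecial_of_palindrome (fun k a b => (hmid k a b).symm) hne0.symm
      hneN.symm hpalj
    exact factorAt_ne_of_ne (k := 0) (Nat.succ_pos N) hne0 (hw.eq_of_mem_rightSpecial h1 h2)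

theorem IsSturmian.height_le_of_language_eq {w w' : ℕ → Fin 2} (hw : IsSturmian w)
    (h : language w' = language w) (n i j : ℕ) :
    height w i n ≤ height w' j n + 1 ∧ height w' j n ≤ height w i n + 1 := by
  obtain ⟨m, hm⟩ := exists_factorAt_eq h.le j n
  rw [← height_congr hm]
  exact ⟨hw.height_le n i m, hw.height_le n m i⟩

/-! ### Christoffel words -/

/-- Extend `S` past `n` by adding `h` per full turn. Each step of size `k` adds `S k` plus an error
of 0 or 1, the first step having none. After `n` steps the total is `k * h`, hence `n * S k ≤ k * h
≤ n * S k + n - 1`. -/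
theorem eq_floor_of_almost_additive {S : ℕ → ℤ} {n : ℕ} {h : ℤ} (h0 : S 0 = 0)
    (hadd : ∀ k l, k + l < n → S k + S l ≤ S (k + l) ∧ S (k + l) ≤ S k + S l + 1)
    (hsym : ∀ k, 0 < k → k < n → S k + S (n - k) = h - 1) {k : ℕ} (hk : 0 < k) (hkn : k < n) :
    S k = k * h / n := by
  have key : ∀ j : ℕ, ((j + 1 : ℕ) : ℤ) * S k ≤
        S ((j + 1) * k % n) + h * (((j + 1) * k / n : ℕ) : ℤ) ∧
      S ((j + 1) * k % n) + h * (((j + 1) * k / n : ℕ) : ℤ) ≤ ((j + 1 : ℕ) : ℤ) * S k + j := by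
    intro j
    induction j with
    | zero => simp [Nat.mod_eq_of_lt hkn, Nat.div_eq_of_lt hkn]
    | succ j ih =>
      set m := (j + 1) * k with hm
      have hr := Nat.mod_lt m (by omega : 0 < n)
      have hdm := Nat.div_add_mod m n
      rw [show (j + 1 + 1) * k = m + k by rw [hm]; ring]
      rcases Nat.lt_or_ge (m % n + k) n with hlt | hge
      · have e1 : (m + k) / n = m / n := by
          rw [Nat.add_div (by omega), Nat.mod_eq_of_lt hkn, Nat.div_eq_of_lt hkn]
          simp [hlt]
        have e2 : (m + k) % n = m % n + k := by
          rw [Nat.add_mod, Nat.mod_eq_of_lt hkn, Nat.mod_eq_of_lt hlt]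
        have := hadd (m % n) k hlt
        rw [e1, e2]
        push_cast at ih ⊢
        constructor <;> linarith
      · have e1 : (m + k) / n = m / n + 1 := by
          rw [Nat.add_div (by omega), Nat.mod_eq_of_lt hkn, Nat.div_eq_of_lt hkn]
          simp [hge]
        have e2 : (m + k) % n = m % n + k - n := by
          rw [Nat.add_mod, Nat.mod_eq_of_lt hkn, Nat.mod_eq_sub_mod hge,
            Nat.mod_eq_of_lt (by omega)]
        -- When the step wraps around, `hsym` trades `S k` for `S (n - k)`.
        have h1 := hadd (n - k) (m % n + k - n) (by omega)
        rw [show n - k + (m % n + k - n) = m % n by omega] at h1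
        have h2 := hsym k hk hkn
        rw [e1, e2]
        push_cast at ih ⊢
        constructor <;> linarith
  have hfin := key (n - 1)
  rw [show n - 1 + 1 = n by omega, Nat.mul_mod_right, Nat.mul_div_cancel_left _ (by omega), h0,
    Nat.cast_sub (by omega : 1 ≤ n)] at hfin
  push_cast at hfin
  refine (((Int.ediv_emod_unique (a := k * h) (b := n) (r := k * h - n * S k) (by omega)).2
    ⟨by ring, ?_, ?_⟩).1).symm
  · linarith
  · linarith

/-- The letters of the lower mechanical word of slope `h / n`. -/
def lowerLetter (h n m : ℕ) : Fin 2 := if m * h % n + h < n then 0 else 1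

/-- The letters of the upper mechanical word of slope `h / n`. -/
def upperLetter (h n m : ℕ) : Fin 2 := if 0 < m * h % n ∧ m * h % n + h ≤ n then 0 else 1

/-! ### Mechanical words of rational slope in integer arithmetic -/

theorem fract_mul_div (h n m : ℕ) :
    Int.fract ((m : ℝ) * (((h : ℚ) / n : ℚ) : ℝ) + 0) = ((m * h % n : ℕ) : ℝ) / n := by
  rw [← Int.fract_div_natCast_eq_div_natCast_mod]
  push_cast
  congr 1
  ring

theorem lowerMechanical_eq {h n : ℕ} (hn : 0 < n) :
    lowerMechanical (((h : ℚ) / n : ℚ) : ℝ) 0 = lowerLetter h n := by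
  funext m
  have hn' : (0 : ℝ) < n := by exact_mod_cast hn
  unfold lowerMechanical lowerLetter
  rw [fract_mul_div]
  congr 1
  rw [eq_iff_iff]
  push_cast
  rw [one_sub_div hn'.ne', div_lt_div_iff_of_pos_right hn', lt_sub_iff_add_lt]
  norm_cast

theorem upperMechanical_eq {h n : ℕ} (hn : 0 < n) :
    upperMechanical (((h : ℚ) / n : ℚ) : ℝ) 0 = upperLetter h n := by
  funext m
  have hn' : (0 : ℝ) < n := by exact_mod_cast hn
  unfold upperMechanical upperLetter
  rw [fract_mul_div]
  congr 1
  rw [eq_iff_iff]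
  push_cast
  rw [one_sub_div hn'.ne', div_le_div_iff_of_pos_right hn', le_sub_iff_add_le,
    div_pos_iff_of_pos_right hn']
  norm_cast

theorem succ_mul_div {h n : ℕ} (hh : h < n) (m : ℕ) :
    (m + 1) * h / n = m * h / n + (lowerLetter h n m).val := by
  rw [Nat.succ_mul, Nat.add_div (by omega), Nat.div_eq_of_lt hh, Nat.mod_eq_of_lt hh, lowerLetter]
  split_ifs <;> simp <;> omega

theorem sum_lowerLetter {h n : ℕ} (hh : h < n) (M : ℕ) :
    ∑ m ∈ Finset.range M, (lowerLetter h n m).val = M * h / n := by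
  induction M with
  | zero => simp
  | succ M ih => rw [Finset.sum_range_succ, ih, succ_mul_div hh]

/-- The right side is the ceiling of `M * h / n`. Slope zero is excluded because there every upper
letter is `1`. -/
theorem sum_upperLetter {h n : ℕ} (h0 : 0 < h) (hh : h < n) (M : ℕ) :
    ∑ m ∈ Finset.range M, (upperLetter h n m).val = (M * h + (n - 1)) / n := by
  induction M with
  | zero =>
    rw [Finset.sum_range_zero, Nat.zero_mul, Nat.zero_add, Nat.div_eq_of_lt (by omega)]
  | succ M ih =>
    rw [Finset.sum_range_succ, ih, upperLetter]
    have hr := Nat.mod_lt (M * h) (by omega : 0 < n)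
    have hdm := Nat.div_add_mod (M * h) n
    generalize M * h / n = q at *
    generalize M * h % n = r at *
    have hc : ∀ s p : ℕ, p * n ≤ s → s < p * n + n → s / n = p := fun s p h1 h2 =>
      Nat.div_eq_of_lt_le h1 (by rwa [Nat.succ_mul])
    rw [Nat.succ_mul, ← hdm]
    have hcomm : n * q = q * n := Nat.mul_comm _ _
    split_ifs with hif
    · rw [hc _ (q + 1), hc _ (q + 1)] <;> (try simp only [Nat.add_mul, Fin.val_zero]) <;> omega
    · rcases Nat.eq_zero_or_pos r with hr0 | hr0
      · rw [hc _ q, hc _ (q + 1)] <;> (try simp only [Nat.add_mul, Fin.val_one]) <;> omega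
      · rw [hc _ (q + 1), hc _ (q + 2)] <;> (try simp only [Nat.add_mul, Fin.val_one]) <;> omega

/-! ### Minimal periods and Christoffel words of reduced slope -/

theorem sum_range_mul_of_periodic {f : ℕ → ℕ} {L : ℕ} (hf : Function.Periodic f L) (j : ℕ) :
    ∑ m ∈ Finset.range (j * L), f m = j * ∑ m ∈ Finset.range L, f m := by
  induction j with
  | zero => simp
  | succ j ih =>
    rw [Nat.succ_mul, Finset.sum_range_add, ih, Nat.succ_mul]
    congr 1
    refine Finset.sum_congr rfl fun m _ => ?_
    rw [Nat.add_comm]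
    exact hf.nat_mul j m

/-- The first `n * L` letters contain exactly `L * h` ones, and by periodicity `n` times those of
one period; so `n` divides `L * h`. -/
theorem dvd_of_periodic {f : ℕ → Fin 2} {h n c L : ℕ} (hn : 0 < n) (hc : c < n)
    (hco : h.Coprime n)
    (hsum : ∀ M, ∑ m ∈ Finset.range M, (f m).val = (M * h + c) / n)
    (hf : Function.Periodic f L) : n ∣ L := by
  have h1 := sum_range_mul_of_periodic (f := fun m => (f m).val) (L := L)
    (fun m => congrArg Fin.val (hf m)) n
  rw [hsum, Nat.mul_assoc, Nat.mul_add_div hn, Nat.div_eq_of_lt hc, Nat.add_zero] at h1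
  exact hco.symm.dvd_of_dvd_mul_right ⟨_, h1⟩

theorem isShortestPeriodWord_iff {f : ℕ → Fin 2} {n : ℕ} (hn : 0 < n)
    (hf : Function.Periodic f n) (hmin : ∀ L, 0 < L → Function.Periodic f L → n ≤ L)
    {v : List (Fin 2)} : IsShortestPeriodWord f v ↔ v = factorAt f 0 n := by
  have hper : ∀ u, IsOmegaPower f u → n ≤ u.length := by
    rintro u ⟨hu, h⟩
    refine hmin _ (List.length_pos_iff.2 hu) fun m => ?_
    have h1 := h (m + u.length)
    rw [Nat.add_mod_right, h m] at h1
    exact (Option.some.inj h1).symm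
  have hpow : IsOmegaPower f (factorAt f 0 n) := by
    refine ⟨fun h => ?_, fun m => ?_⟩
    · have := congrArg List.length h
      simp at this
      omega
    · rw [length_factorAt, List.getElem?_eq_getElem (by simpa using Nat.mod_lt m hn)]
      simp [hf.map_mod_nat]
  constructor
  · rintro ⟨hv, hshort⟩
    have hlen : v.length = n := le_antisymm (by simpa using hshort _ hpow) (hper v hv)
    refine List.ext_getElem (by simpa using hlen) fun k h1 h2 => ?_
    have := hv.2 k
    rw [Nat.mod_eq_of_lt h1, List.getElem?_eq_getElem h1] at this
    simpa using this
  · rintro rfl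
    exact ⟨hpow, fun u hu => by simpa using hper u hu⟩

theorem periodic_lowerLetter (h n : ℕ) : Function.Periodic (lowerLetter h n) n := by
  intro m
  simp [lowerLetter, Nat.add_mul]

theorem periodic_upperLetter (h n : ℕ) : Function.Periodic (upperLetter h n) n := by
  intro m
  simp [upperLetter, Nat.add_mul]

theorem isShortestPeriodWord_lowerLetter_iff {h n : ℕ} (hh : h < n) (hco : h.Coprime n)
    {v : List (Fin 2)} :
    IsShortestPeriodWord (lowerLetter h n) v ↔ v = factorAt (lowerLetter h n) 0 n := by
  refine isShortestPeriodWord_iff (by omega) (periodic_lowerLetter h n) fun L hL hp => ?_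
  exact Nat.le_of_dvd hL (dvd_of_periodic (c := 0) (by omega) (by omega) hco
    (sum_lowerLetter hh) hp)

theorem isShortestPeriodWord_upperLetter_iff {h n : ℕ} (hh : h < n) (hco : h.Coprime n)
    {v : List (Fin 2)} :
    IsShortestPeriodWord (upperLetter h n) v ↔ v = factorAt (upperLetter h n) 0 n := by
  refine isShortestPeriodWord_iff (by omega) (periodic_upperLetter h n) fun L hL hp => ?_
  rcases Nat.eq_zero_or_pos h with rfl | h0
  · rw [Nat.coprime_zero_left] at hco
    omega
  · exact Nat.le_of_dvd hL (dvd_of_periodic (c := n - 1) (by omega) (by omega) hco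
      (sum_upperLetter h0 hh) hp)

theorem exists_coprime_eq_div {α : ℚ} (h0 : 0 ≤ α) (h1 : α < 1) :
    ∃ h n : ℕ, h < n ∧ h.Coprime n ∧ α = (h : ℚ) / n := by
  obtain ⟨m, hm⟩ := Int.eq_ofNat_of_zero_le (Rat.num_nonneg.2 h0)
  have hα : α = (m : ℚ) / α.den := by
    conv_lhs => rw [← Rat.num_div_den α, hm]
    simp
  refine ⟨m, α.den, ?_, ?_, hα⟩
  · rw [hα, div_lt_one (by exact_mod_cast α.den_pos)] at h1
    exact_mod_cast h1
  · simpa [hm] using α.reduced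

theorem isLowerChristoffel_iff {v : List (Fin 2)} : IsLowerChristoffel v ↔
    ∃ h n, h < n ∧ h.Coprime n ∧ v = factorAt (lowerLetter h n) 0 n := by
  constructor
  · rintro ⟨α, h0, h1, hv⟩
    obtain ⟨h, n, hh, hco, rfl⟩ := exists_coprime_eq_div h0 h1
    rw [lowerMechanical_eq (by omega), isShortestPeriodWord_lowerLetter_iff hh hco] at hv
    exact ⟨h, n, hh, hco, hv⟩
  · rintro ⟨h, n, hh, hco, hv⟩
    have hn : (0 : ℚ) < n := by exact_mod_cast (by omega : 0 < n)
    refine ⟨(h : ℚ) / n, by positivity, (div_lt_one hn).2 (by exact_mod_cast hh), ?_⟩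
    rw [lowerMechanical_eq (by omega), isShortestPeriodWord_lowerLetter_iff hh hco]
    exact hv

theorem isUpperChristoffel_iff {v : List (Fin 2)} : IsUpperChristoffel v ↔
    ∃ h n, h < n ∧ h.Coprime n ∧ v = factorAt (upperLetter h n) 0 n := by
  constructor
  · rintro ⟨α, h0, h1, hv⟩
    obtain ⟨h, n, hh, hco, rfl⟩ := exists_coprime_eq_div h0 h1
    rw [upperMechanical_eq (by omega), isShortestPeriodWord_upperLetter_iff hh hco] at hv
    exact ⟨h, n, hh, hco, hv⟩
  · rintro ⟨h, n, hh, hco, hv⟩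
    have hn : (0 : ℚ) < n := by exact_mod_cast (by omega : 0 < n)
    refine ⟨(h : ℚ) / n, by positivity, (div_lt_one hn).2 (by exact_mod_cast hh), ?_⟩
    rw [upperMechanical_eq (by omega), isShortestPeriodWord_upperLetter_iff hh hco]
    exact hv

theorem isChristoffel_singleton (a : Fin 2) : IsChristoffel [a] := by
  rcases Fin.exists_fin_two.1 ⟨a, rfl⟩ with rfl | rfl
  · exact Or.inl (isLowerChristoffel_iff.2 ⟨0, 1, by simp, by simp, by decide⟩)
  · exact Or.inr (isUpperChristoffel_iff.2 ⟨0, 1, by simp, by simp, by decide⟩)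

/-! ### Mirror images of Christoffel words -/

theorem reverse_factorAt_eq_iff {f g : ℕ → Fin 2} {i j n : ℕ} :
    (factorAt f i n).reverse = factorAt g j n ↔ ∀ k < n, f (i + (n - 1 - k)) = g (j + k) := by
  constructor
  · intro h k hk
    have := List.getElem_of_eq h (i := k) (by simpa using hk)
    simpa using this
  · intro h
    refine List.ext_getElem (by simp) fun k h1 h2 => ?_
    simpa using h k (by simpa using h2)

/-- The residues `a`, `b` of `k * h` and `(n - 1 - k) * h` satisfy `a + b + h ≡ 0` modulo `n`, so
this sum is `n` or `2 * n`. -/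
theorem lowerLetter_reverse {h n k : ℕ} (h0 : 0 < h) (hh : h < n) (hk : k < n) :
    lowerLetter h n (n - 1 - k) = upperLetter h n k := by
  obtain ⟨c, hc⟩ : n ∣ k * h % n + (n - 1 - k) * h % n + h := by
    rw [Nat.dvd_iff_mod_eq_zero, Nat.add_mod, ← Nat.add_mod (k * h), ← Nat.add_mod,
      ← Nat.add_mul, ← Nat.succ_mul,
      show (k + (n - 1 - k)).succ = n by omega, Nat.mul_mod_right]
  have ha := Nat.mod_lt (k * h) (by omega : 0 < n)
  have hb := Nat.mod_lt ((n - 1 - k) * h) (by omega : 0 < n)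
  unfold lowerLetter upperLetter
  generalize k * h % n = a at *
  generalize (n - 1 - k) * h % n = b at *
  congr 1
  rw [eq_iff_iff]
  have hc3 : c < 3 := by
    by_contra hc3
    have : n * 3 ≤ n * c := Nat.mul_le_mul_left n (by omega)
    omega
  interval_cases c <;> omega

/-- The two conventions disagree only if `n` divides `k * h` or `(k + 1) * h`, which coprimality
forbids in the interior. -/
theorem lowerLetter_eq_upperLetter {h n k : ℕ} (hco : h.Coprime n) (h0 : 0 < k)
    (hk : k + 1 < n) : lowerLetter h n k = upperLetter h n k := by
  have hnd : ∀ m, 0 < m → m < n → m * h % n ≠ 0 := by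
    intro m hm hmn e
    have := hco.symm.dvd_of_dvd_mul_right (Nat.dvd_of_mod_eq_zero e)
    exact absurd (Nat.le_of_dvd hm this) (by omega)
  have h1 := hnd k h0 (by omega)
  have h2 := hnd (k + 1) (by omega) hk
  rw [Nat.succ_mul, ← Nat.mod_add_mod] at h2
  unfold lowerLetter upperLetter
  generalize k * h % n = a at *
  congr 1
  rw [eq_iff_iff]
  have : a + h ≠ n := by
    intro e
    rw [e] at h2
    simp at h2
  omega

theorem lowerLetter_zero {h n : ℕ} (hh : h < n) : lowerLetter h n 0 = 0 := by
  simp [lowerLetter, hh]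

theorem upperLetter_zero (h n : ℕ) : upperLetter h n 0 = 1 := by
  simp [upperLetter]

theorem lowerLetter_last {h n : ℕ} (h0 : 0 < h) (hh : h < n) : lowerLetter h n (n - 1) = 1 := by
  rw [← upperLetter_zero h n, ← lowerLetter_reverse h0 hh (by omega), Nat.sub_zero]

theorem upperLetter_last {h n : ℕ} (h0 : 0 < h) (hh : h < n) : upperLetter h n (n - 1) = 0 := by
  rw [← lowerLetter_reverse h0 hh (by omega), Nat.sub_self, lowerLetter_zero hh]

/-- The words `w` and `w'` agree at `i` and `n = 1`, or they differ exactly at the ends of the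
interval `[i, i + n)`. -/
def IsBlock (w w' : ℕ → Fin 2) (i n : ℕ) : Prop :=
  (n = 1 ∧ w i = w' i) ∨
    (2 ≤ n ∧ w i ≠ w' i ∧ (∀ k, 0 < k → k + 1 < n → w (i + k) = w' (i + k)) ∧
      w (i + (n - 1)) ≠ w' (i + (n - 1)))

theorem IsBlock.eq {w w' : ℕ → Fin 2} {i m n : ℕ} (hm : IsBlock w w' i m)
    (hn : IsBlock w w' i n) : m = n := by
  rcases hm with ⟨rfl, h⟩ | ⟨h2, h, hmid, hlast⟩ <;> rcases hn with ⟨rfl, h'⟩ | ⟨h2', h', hmid', hlast'⟩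
  · rfl
  · exact absurd h h'
  · exact absurd h' h
  · rcases Nat.lt_trichotomy m n with hlt | heq | hlt
    · exact absurd (hmid' (m - 1) (by omega) (by omega)) hlast
    · exact heq
    · exact absurd (hmid (n - 1) (by omega) (by omega)) hlast'

theorem isBlock_of_isChristoffel {w w' : ℕ → Fin 2} {i n : ℕ}
    (hv : IsChristoffel (factorAt w i n)) (hrev : (factorAt w i n).reverse = factorAt w' i n) :
    IsBlock w w' i n := by
  rw [reverse_factorAt_eq_iff] at hrev
  rw [IsChristoffel, isLowerChristoffel_iff, isUpperChristoffel_iff] at hv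
  have hone : n = 1 → IsBlock w w' i n := by
    rintro rfl
    exact Or.inl ⟨rfl, by simpa using hrev 0 one_pos⟩
  rcases hv with ⟨h, m, hh, hco, hv⟩ | ⟨h, m, hh, hco, hv⟩ <;>
  · obtain rfl : n = m := by simpa using congrArg List.length hv
    simp only [factorAt_eq_iff, Nat.zero_add] at hv
    by_cases hn : n = 1
    · exact hone hn
    have h0 : 0 < h := by
      rcases Nat.eq_zero_or_pos h with rfl | h0
      · exact absurd ((Nat.coprime_zero_left n).1 hco) hn
      · exact h0
    have h2 : 2 ≤ n := by omega
    refine Or.inr ⟨h2, ?_, fun k hk hkn => ?_, ?_⟩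
    · have e1 := hv 0 (by omega)
      have e2 := hrev 0 (by omega)
      rw [hv _ (by omega)] at e2
      simp only [Nat.add_zero, Nat.sub_zero] at e1 e2
      rw [e1, ← e2]
      simp [lowerLetter_zero hh, upperLetter_zero, lowerLetter_last h0 hh, upperLetter_last h0 hh]
    · have e := lowerLetter_eq_upperLetter hco hk hkn
      have e2 := lowerLetter_reverse h0 hh (k := k) (by omega)
      have e3 := lowerLetter_eq_upperLetter hco (k := n - 1 - k) (by omega) (by omega)
      rw [← hrev k (by omega), hv _ (by omega), hv _ (by omega)]
      simp only [e2, e, ← e3]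
    · have e2 := hrev (n - 1) (by omega)
      rw [Nat.sub_self, hv 0 (by omega)] at e2
      rw [hv _ (by omega), ← e2]
      simp [lowerLetter_zero hh, upperLetter_zero, lowerLetter_last h0 hh, upperLetter_last h0 hh]

/-! ### From balance to Christoffel words -/

theorem height_nonneg (w : ℕ → Fin 2) (i n : ℕ) : 0 ≤ height w i n :=
  Finset.sum_nonneg fun _ _ => by positivity

theorem height_le_length (w : ℕ → Fin 2) (i n : ℕ) : height w i n ≤ n := by
  induction n with
  | zero => simp
  | succ n ih =>
    rw [height_succ]
    push_cast
    omega

/-- Two factors `0p1` and `1p0` of a balanced language are the lower and the upper Christoffel word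
of the same slope. -/
theorem exists_letters_of_isSturmian {w w' : ℕ → Fin 2} (hw : IsSturmian w) (hw' : IsSturmian w')
    (hL : language w' = language w) {i n : ℕ} (hn : 2 ≤ n) (hi : w i = 0) (hi' : w' i = 1)
    (hmid : ∀ k, 0 < k → k + 1 < n → w (i + k) = w' (i + k))
    (hl : w (i + (n - 1)) = 1) (hl' : w' (i + (n - 1)) = 0) :
    ∃ h, 0 < h ∧ h < n ∧ h.Coprime n ∧ (∀ k < n, w (i + k) = lowerLetter h n k) ∧
      ∀ k < n, w' (i + k) = upperLetter h n k := by
  obtain ⟨h, hh⟩ := Int.eq_ofNat_of_zero_le (height_nonneg w i n)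
  have hS' : ∀ k, 0 < k → k < n → height w' i k = height w i k + 1 := by
    intro k hk hkn
    induction k with
    | zero => omega
    | succ k ih =>
      rw [height_succ, height_succ]
      rcases Nat.eq_zero_or_pos k with rfl | h0
      · simp [hi, hi']
      · rw [ih h0 (by omega), hmid k h0 hkn]
        ring
  have hh' : height w' i n = h := by
    have h1 := height_succ w' i (n - 1)
    have h2 := height_succ w i (n - 1)
    rw [hS' (n - 1) (by omega) (by omega), hl'] at h1
    rw [hl] at h2
    rw [Nat.sub_add_cancel (by omega)] at h1 h2
    simp at h1 h2
    omega
  have hsplit : ∀ (u : ℕ → Fin 2) (k : ℕ), k ≤ n →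
      height u i n = height u i (n - k) + height u (i + (n - k)) k := by
    intro u k hk
    rw [← height_add, Nat.sub_add_cancel hk]
  -- Since `w'` has one more `1` at `i`, balance makes the prefixes of `0p1` the lightest factors of
  -- their length.
  have hbound : ∀ k j, 0 < k → k < n → height w i k ≤ height w j k ∧
      height w j k ≤ height w i k + 1 := by
    intro k j hk hkn
    have := (hw.height_le_of_language_eq hL k j i).2
    have := hw.height_le k j i
    have := hS' k hk hkn
    omega
  have hsym : ∀ k, 0 < k → k < n → height w i k + height w i (n - k) = (h : ℤ) - 1 := by
    intro k hk hkn
    have h1 := hsplit w k hkn.le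
    have h2 := hsplit w' k hkn.le
    have := hbound k (i + (n - k)) hk hkn
    have := hS' (n - k) (by omega) (by omega)
    have := hS' k hk hkn
    have := hw'.height_le k i (i + (n - k))
    omega
  have hadd : ∀ k l, k + l < n → height w i k + height w i l ≤ height w i (k + l) ∧
      height w i (k + l) ≤ height w i k + height w i l + 1 := by
    intro k l hkl
    rw [height_add]
    rcases Nat.eq_zero_or_pos l with rfl | hl0
    · simp
    · have := hbound l (i + k) hl0 (by omega)
      omega
  have hhn : h < n := by
    have h1 := height_add w i 1 (n - 1)
    have h2 := height_le_length w (i + 1) (n - 1)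
    have h3 : height w i 1 = 0 := by simp [height, hi]
    rw [show 1 + (n - 1) = n by omega] at h1
    omega
  have hfloor : ∀ k, k ≤ n → height w i k = ((k * h / n : ℕ) : ℤ) := by
    intro k hk
    rcases Nat.eq_zero_or_pos k with rfl | h0
    · simp
    rcases Nat.lt_or_ge k n with hkn | hkn
    · push_cast
      exact eq_floor_of_almost_additive (S := height w i) (by simp) hadd hsym h0 hkn
    · obtain rfl : k = n := by omega
      rw [hh, Nat.mul_div_cancel_left _ (by omega)]
  have hlow : ∀ k < n, w (i + k) = lowerLetter h n k := by
    intro k hk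
    have h1 := height_succ w i k
    rw [hfloor k hk.le, hfloor (k + 1) hk, succ_mul_div hhn] at h1
    push_cast at h1
    omega
  have h0 : 0 < h := by
    rcases Nat.eq_zero_or_pos h with rfl | h0
    · rw [hlow _ (by omega)] at hl
      simp [lowerLetter, show 0 < n by omega] at hl
    · exact h0
  -- With a common divisor `g > 1` and `b = n / g`, the floors at `b` and `n - b` are exact and sum
  -- to `h`, not `h - 1`.
  have hco : h.Coprime n := by
    by_contra hco
    obtain ⟨a, ha⟩ := Nat.gcd_dvd_left h n
    obtain ⟨b, hb⟩ := Nat.gcd_dvd_right h n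
    have hg : 1 < h.gcd n := by
      have := Nat.gcd_pos_of_pos_left n h0
      have : h.gcd n ≠ 1 := hco
      omega
    generalize h.gcd n = g at *
    subst ha hb
    have hb0 : 0 < b := Nat.pos_of_mul_pos_left (by omega : 0 < g * b)
    have hbn : b < g * b := by nlinarith
    have h1 := hsym b hb0 hbn
    have h2 : g * b - b = (g - 1) * b := by rw [Nat.sub_mul, Nat.one_mul]
    rw [hfloor b hbn.le, hfloor _ (Nat.sub_le _ _), h2,
      show b * (g * a) = g * b * a by ring, Nat.mul_div_cancel_left _ (by omega),
      show (g - 1) * b * (g * a) = g * b * ((g - 1) * a) by ring,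
      Nat.mul_div_cancel_left _ (by omega)] at h1
    push_cast [Nat.cast_sub hg.le] at h1
    linarith
  refine ⟨h, h0, hhn, hco, hlow, fun k hk => ?_⟩
  rcases Nat.eq_zero_or_pos k with rfl | hk0
  · rw [Nat.add_zero, hi', upperLetter_zero]
  rcases Nat.lt_or_ge (k + 1) n with hkn | hkn
  · rw [← hmid k hk0 hkn, hlow k hk, lowerLetter_eq_upperLetter hco hk0 hkn]
  · obtain rfl : k = n - 1 := by omega
    rw [hl', upperLetter_last h0 hhn]

theorem isChristoffel_of_letters {w w' : ℕ → Fin 2} {i h n : ℕ} (h0 : 0 < h) (hh : h < n)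
    (hco : h.Coprime n) (hw : ∀ k < n, w (i + k) = lowerLetter h n k)
    (hw' : ∀ k < n, w' (i + k) = upperLetter h n k) :
    IsChristoffel (factorAt w i n) ∧ IsChristoffel (factorAt w' i n) ∧
      (factorAt w i n).reverse = factorAt w' i n := by
  refine ⟨Or.inl (isLowerChristoffel_iff.2 ⟨h, n, hh, hco, ?_⟩),
    Or.inr (isUpperChristoffel_iff.2 ⟨h, n, hh, hco, ?_⟩), ?_⟩
  · rw [factorAt_eq_iff]
    simpa using hw
  · rw [factorAt_eq_iff]
    simpa using hw'
  · rw [reverse_factorAt_eq_iff]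
    intro k hk
    rw [hw _ (by omega), hw' k hk, lowerLetter_reverse h0 hh hk]

/-! ### Existence of blocks -/

/-- Otherwise `w = u0c` and `w' = u'1c` with `u`, `u'` of length `i` and equal height. Comparing
prefixes with factors starting at `i`, balance forces the height of `c` to grow by that of `u` over
any `i` further letters, so `c` has period `i`. -/
theorem exists_ne_after_of_letters {w w' : ℕ → Fin 2} (hw : IsSturmian w) (hw' : IsSturmian w')
    (hL : language w' = language w) {i : ℕ} (hpos : 0 < i) (hheight : height w 0 i = height w' 0 i)
    (hi : w i = 0) (hi' : w' i = 1) : ∃ m, 0 < m ∧ w (i + m) ≠ w' (i + m) := by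
  by_contra! hcon
  have hone : ∀ m, height w i (1 + m) = height w (i + 1) m := by
    intro m
    rw [height_add]
    simp [height, hi]
  have hone' : ∀ m, height w' i (1 + m) = height w (i + 1) m + 1 := by
    intro m
    rw [height_add, show height w' (i + 1) m = height w (i + 1) m from ?_]
    · simp [height, hi', add_comm]
    · refine Finset.sum_congr rfl fun k _ => ?_
      rw [Nat.add_assoc, hcon _ (by omega)]
  have hper : ∀ m, height w (i + 1) (m + i) = height w 0 i + height w (i + 1) m := by
    intro m
    have h1 := height_add w 0 i (1 + m)
    have h2 := height_add w' 0 i (1 + m)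
    have h3 := hone (m + i)
    have h4 := hone' (m + i)
    rw [Nat.zero_add, hone] at h1
    rw [Nat.zero_add, hone'] at h2
    rw [show 1 + (m + i) = i + (1 + m) by omega] at h3 h4
    have h5 := (hw.height_le_of_language_eq hL (i + (1 + m)) i 0).2
    have h6 := (hw.height_le_of_language_eq hL (i + (1 + m)) 0 i).2
    have h7 := hw'.height_le (i + (1 + m)) 0 i
    have h8 := hw.height_le (i + (1 + m)) i 0
    omega
  refine hw.not_eventuallyPeriodic ⟨i + 1, i, hpos, fun j hj => ?_⟩
  obtain ⟨m, rfl⟩ := Nat.exists_eq_add_of_le hj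
  have h1 := hper m
  have h2 := hper (m + 1)
  rw [show m + 1 + i = m + i + 1 by omega, height_succ, height_succ, h1] at h2
  rw [show i + 1 + (m + i) = i + 1 + m + i by omega] at h2
  omega

theorem exists_ne_after {w w' : ℕ → Fin 2} (hw : IsSturmian w) (hw' : IsSturmian w')
    (hL : language w' = language w) {i : ℕ} (hpos : 0 < i) (hheight : height w 0 i = height w' 0 i)
    (hne : w i ≠ w' i) : ∃ m, 0 < m ∧ w (i + m) ≠ w' (i + m) := by
  rcases Fin.exists_fin_two.1 ⟨w i, rfl⟩ with h | h
  · exact exists_ne_after_of_letters hw hw' hL hpos hheight h (by omega)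
  · obtain ⟨m, hm, hm'⟩ :=
      exists_ne_after_of_letters hw' hw hL.symm hpos hheight.symm (by omega) h
    exact ⟨m, hm, hm'.symm⟩

/-- The words `w` and `w'` have mirror image Christoffel words of length `n` at position `i`. -/
def IsChristoffelBlock (w w' : ℕ → Fin 2) (i n : ℕ) : Prop :=
  0 < n ∧ IsChristoffel (factorAt w i n) ∧ (factorAt w i n).reverse = factorAt w' i n ∧
    height w i n = height w' i n

theorem exists_christoffel_pair {w w' : ℕ → Fin 2} (hw : IsSturmian w) (hw' : IsSturmian w')
    (hL : language w' = language w) {i : ℕ} (hi : w i = 0) (hi' : w' i = 1)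
    (hdiff : ∃ m, 0 < m ∧ w (i + m) ≠ w' (i + m)) :
    ∃ n, IsChristoffelBlock w w' i n ∧ IsChristoffelBlock w' w i n := by
  classical
  obtain ⟨hm0, hm⟩ := Nat.find_spec hdiff
  have hmin : ∀ k, 0 < k → k < Nat.find hdiff → w (i + k) = w' (i + k) := by
    intro k hk hlt
    by_contra hne
    exact Nat.find_min hdiff hlt ⟨hk, hne⟩
  generalize Nat.find hdiff = m at *
  have hdist : ∀ k, k < m → height w' i (k + 1) = height w i (k + 1) + 1 := by
    intro k hk
    induction k with
    | zero => simp [height, hi, hi']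
    | succ k ih =>
      rw [height_succ, height_succ w, ih (by omega), hmin (k + 1) (by omega) hk]
      ring
  have h1 := hdist (m - 1) (by omega)
  rw [Nat.sub_add_cancel hm0] at h1
  have h2 := height_succ w i m
  have h3 := height_succ w' i m
  have h4 := (hw.height_le_of_language_eq hL (m + 1) i i).2
  have hl : w (i + m) = 1 := by omega
  have hl' : w' (i + m) = 0 := by omega
  obtain ⟨h, h0, hh, hco, hlow, hup⟩ := exists_letters_of_isSturmian hw hw' hL (n := m + 1)
    (by omega) hi hi' (fun k hk hkm => hmin k hk (by omega)) hl hl'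
  obtain ⟨c1, c2, c3⟩ := isChristoffel_of_letters h0 hh hco hlow hup
  have heq : height w i (m + 1) = height w' i (m + 1) := by
    rw [h2, h3, h1, hl, hl']
    simp
  exact ⟨m + 1, ⟨by omega, c1, c3, heq⟩, by omega, c2, by rw [← c3, List.reverse_reverse], heq.symm⟩

theorem exists_christoffelBlock {w w' : ℕ → Fin 2} (hw : IsSturmian w) (hw' : IsSturmian w')
    (hL : language w' = language w) {i : ℕ}
    (hdiff : w i ≠ w' i → ∃ m, 0 < m ∧ w (i + m) ≠ w' (i + m)) :
    ∃ n, IsChristoffelBlock w w' i n := by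
  by_cases h : w i = w' i
  · refine ⟨1, one_pos, ?_, ?_, ?_⟩
    · exact isChristoffel_singleton (w (i + 0))
    · rw [reverse_factorAt_eq_iff]
      simpa using h
    · simp [height, h]
  · rcases Fin.exists_fin_two.1 ⟨w i, rfl⟩ with h0 | h1
    · obtain ⟨n, hn, -⟩ := exists_christoffel_pair hw hw' hL h0 (by omega) (hdiff h)
      exact ⟨n, hn⟩
    · obtain ⟨m, hm, hm'⟩ := hdiff h
      obtain ⟨n, -, hn⟩ := exists_christoffel_pair hw' hw hL.symm (by omega) h1 ⟨m, hm, hm'.symm⟩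
      exact ⟨n, hn⟩

theorem eq_cons_tail {w c : ℕ → Fin 2} (h : ∀ m, c m = w (m + 1)) : w = cons (w 0) c := by
  funext n
  cases n with
  | zero => rfl
  | succ n => exact (h n).symm

theorem factorAt_cons (a : Fin 2) (c : ℕ → Fin 2) (n : ℕ) :
    factorAt (cons a c) 0 (n + 1) = a :: factorAt c 0 n := by
  simp [factorAt, List.range_succ_eq_map, Function.comp_def, cons]

theorem exists_characteristic {w w' : ℕ → Fin 2} (hw : IsSturmian w)
    (hL : language w' = language w) (hne : w 0 ≠ w' 0) (h : ∀ m, 0 < m → w m = w' m) :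
    ∃ c, IsCharacteristic c ∧ language c = language w ∧
      ({w, w'} : Set (ℕ → Fin 2)) = {cons 0 c, cons 1 c} := by
  obtain ⟨hc, hcL⟩ := isSturmian_tail hw 1
  set c : ℕ → Fin 2 := fun i => w (1 + i) with hcdef
  have e : w = cons (w 0) c := eq_cons_tail fun m => by rw [hcdef, Nat.add_comm m 1]
  have e' : w' = cons (w' 0) c := eq_cons_tail fun m => by
    simp only [hcdef, Nat.add_comm m 1, h _ (show 0 < 1 + m by omega)]
  refine ⟨c, ⟨hc, fun n a => ?_⟩, hcL, ?_⟩
  · rw [hcL]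
    by_cases ha : a = w 0
    · exact ⟨0, n + 1, by rw [e, factorAt_cons, ← ha]⟩
    · have ha' : a = w' 0 := by omega
      rw [← hL]
      exact ⟨0, n + 1, by rw [e', factorAt_cons, ← ha']⟩
  · rcases Fin.exists_fin_two.1 ⟨w 0, rfl⟩ with h0 | h1
    · rw [h0] at e
      rw [show w' 0 = 1 by omega] at e'
      rw [← e, ← e']
    · rw [h1] at e
      rw [show w' 0 = 0 by omega] at e'
      rw [← e, ← e', Set.pair_comm]

/-! ### Infinite products -/

theorem partialProduct_succ (x : ℕ → List (Fin 2)) (k : ℕ) :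
    partialProduct x (k + 1) = partialProduct x k ++ x k := by
  simp [partialProduct, List.range_succ]

theorem length_partialProduct_reverse (x : ℕ → List (Fin 2)) (k : ℕ) :
    (partialProduct (fun k => (x k).reverse) k).length = (partialProduct x k).length := by
  induction k with
  | zero => rfl
  | succ k ih => simp [partialProduct_succ, ih]

theorem isInfiniteProduct_of_cuts {w : ℕ → Fin 2} {x : ℕ → List (Fin 2)} {cut len : ℕ → ℕ}
    (h0 : cut 0 = 0) (hlen : ∀ k, 0 < len k) (hcut : ∀ k, cut (k + 1) = cut k + len k)
    (hx : ∀ k, x k = factorAt w (cut k) (len k)) : IsInfiniteProduct w x := by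
  have hpp : ∀ k, partialProduct x k = factorAt w 0 (cut k) := by
    intro k
    induction k with
    | zero => rw [h0]; rfl
    | succ k ih => rw [partialProduct_succ, ih, hx, hcut, factorAt_add, Nat.zero_add]
  refine ⟨fun k => by rw [hpp, length_factorAt], fun n => ⟨n, ?_⟩⟩
  rw [hpp, length_factorAt]
  induction n with
  | zero => omega
  | succ n ih =>
    have := hlen n
    rw [hcut]
    omega

theorem IsInfiniteProduct.apply_eq {w : ℕ → Fin 2} {x : ℕ → List (Fin 2)}
    (h : IsInfiniteProduct w x) (k : ℕ) :
    x k = factorAt w (partialProduct x k).length (x k).length := by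
  have h1 := h.1 (k + 1)
  rw [partialProduct_succ, List.length_append, factorAt_add, Nat.zero_add] at h1
  exact (List.append_inj h1 (by simp)).2

theorem IsInfiniteProduct.unique {w w' : ℕ → Fin 2} {x : ℕ → List (Fin 2)}
    (h : IsInfiniteProduct w x) (h' : IsInfiniteProduct w' x) : w = w' := by
  funext n
  obtain ⟨k, hk⟩ := h.2 (n + 1)
  have := factorAt_eq_iff.1 ((h.1 k).symm.trans (h'.1 k)) n (by omega)
  simpa using this

theorem IsRCDeterminedBy.isBlock {w w' : ℕ → Fin 2} {x : ℕ → List (Fin 2)}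
    (h : IsRCDeterminedBy w w' x) (k : ℕ) :
    IsBlock w w' (partialProduct x k).length (x k).length := by
  obtain ⟨hc, hp, -, hp'⟩ := h
  have h1 := hp.apply_eq k
  have h2 := hp'.apply_eq k
  rw [length_partialProduct_reverse, List.length_reverse] at h2
  exact isBlock_of_isChristoffel (by rw [← h1]; exact hc k) (by rw [← h1, ← h2])

theorem IsRCDeterminedBy.unique {w w' : ℕ → Fin 2} {x y : ℕ → List (Fin 2)}
    (hx : IsRCDeterminedBy w w' x) (hy : IsRCDeterminedBy w w' y) : x = y := by
  have hstep : ∀ k, (partialProduct x k).length = (partialProduct y k).length → x k = y k := by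
    intro k hk
    have h1 := hx.isBlock k
    rw [hk] at h1
    rw [hx.2.1.apply_eq k, hy.2.1.apply_eq k, hk, h1.eq (hy.isBlock k)]
  have hlen : ∀ k, (partialProduct x k).length = (partialProduct y k).length := by
    intro k
    induction k with
    | zero => rfl
    | succ k ih => rw [partialProduct_succ, partialProduct_succ, hstep k ih, List.length_append,
        List.length_append, ih]
  exact funext fun k => hstep k (hlen k)

theorem exists_isRCDeterminedBy {w w' : ℕ → Fin 2} (hw : IsSturmian w) (hw' : IsSturmian w')
    (hL : language w' = language w)
    (hex : ¬ ∃ c : ℕ → Fin 2, IsCharacteristic c ∧ language c = language w ∧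
      ({w, w'} : Set (ℕ → Fin 2)) = {cons 0 c, cons 1 c}) :
    ∃ x, IsRCDeterminedBy w w' x := by
  have hblock : ∀ i, height w 0 i = height w' 0 i → ∃ n, IsChristoffelBlock w w' i n := by
    intro i hi
    refine exists_christoffelBlock hw hw' hL fun hne => ?_
    rcases Nat.eq_zero_or_pos i with rfl | hpos
    · by_contra! hcon
      simp only [Nat.zero_add] at hcon
      exact hex (exists_characteristic hw hL hne hcon)
    · exact exists_ne_after hw hw' hL hpos hi hne
  -- `len` is total, but its values matter only at positions where the prefix heights agree; `hcut`
  -- keeps every cut there.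
  choose! len hlen using hblock
  let cut : ℕ → ℕ := fun k => Nat.rec 0 (fun _ i => i + len i) k
  have hcut : ∀ k, height w 0 (cut k) = height w' 0 (cut k) := by
    intro k
    induction k with
    | zero => simp [cut]
    | succ k ih =>
      change height w 0 (cut k + len (cut k)) = height w' 0 (cut k + len (cut k))
      rw [height_add, height_add, ih, Nat.zero_add, (hlen _ ih).2.2.2]
  refine ⟨fun k => factorAt w (cut k) (len (cut k)), fun k => (hlen _ (hcut k)).2.1,
    isInfiniteProduct_of_cuts (cut := cut) (len := fun k => len (cut k)) rfl
      (fun k => (hlen _ (hcut k)).1) (fun _ => rfl) fun _ => rfl, hw',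
    isInfiniteProduct_of_cuts (cut := cut) (len := fun k => len (cut k)) rfl
      (fun k => (hlen _ (hcut k)).1) (fun _ => rfl) fun k => (hlen _ (hcut k)).2.2.1⟩

/-! ### Uncountability -/

/-- A pair `(i, n)` encodes the factor of length `n` at `i`. By recurrence it occurs again, and by
aperiodicity the two continuations eventually differ, so one of them departs from `z`. -/
theorem IsSturmian.exists_extension_ne {w : ℕ → Fin 2} (hw : IsSturmian w) (z : ℕ → Fin 2)
    (p : ℕ × ℕ) : ∃ q : ℕ × ℕ, p.2 < q.2 ∧ (∀ j < p.2, w (q.1 + j) = w (p.1 + j)) ∧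
      ∃ j < q.2, w (q.1 + j) ≠ z j := by
  obtain ⟨i, n⟩ := p
  obtain ⟨i', hi', he⟩ := hw.recurrent i n (i + 1)
  rw [factorAt_eq_iff] at he
  have hdiff : ∃ j, w (i' + j) ≠ w (i + j) := by
    by_contra! hcon
    refine hw.not_eventuallyPeriodic ⟨i, i' - i, by omega, fun j hj => ?_⟩
    have := hcon (j - i)
    rwa [show i' + (j - i) = j + (i' - i) by omega, show i + (j - i) = j by omega] at this
  obtain ⟨j, hj⟩ := hdiff
  have hjn : n ≤ j := by
    by_contra hlt
    exact hj (he j (by omega))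
  by_cases hz : w (i + j) = z j
  · exact ⟨(i', j + 1), by simp only; omega, he, j, by simp, by rwa [← hz]⟩
  · exact ⟨(i, j + 1), by simp only; omega, fun _ _ => rfl, j, by simp, hz⟩

/-- Diagonal argument: nested factors of `w`, the `k`-th extension avoiding the `k`-th listed word,
converge to an unlisted word. -/
theorem IsSturmian.not_countable_language_subset {w : ℕ → Fin 2} (hw : IsSturmian w) :
    ¬ {v : ℕ → Fin 2 | language v ⊆ language w}.Countable := by
  intro hcount
  obtain ⟨f, hf⟩ := hcount.exists_eq_range ⟨w, Set.Subset.refl (language w)⟩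
  choose next h1 h2 h3 using hw.exists_extension_ne
  let st : ℕ → ℕ × ℕ := fun k => Nat.rec (0, 0) (fun k p => next (f k) p) k
  have hst : ∀ k, st (k + 1) = next (f k) (st k) := fun _ => rfl
  have hlt : ∀ k, (st k).2 < (st (k + 1)).2 := fun k => h1 (f k) (st k)
  have hmono : Monotone fun k => (st k).2 := monotone_nat_of_le_succ fun k => (hlt k).le
  have hge : ∀ k, k ≤ (st k).2 := by
    intro k
    induction k with
    | zero => omega
    | succ k ih =>
      have := hlt k
      omega
  have hcons : ∀ k l, k ≤ l → ∀ j < (st k).2, w ((st l).1 + j) = w ((st k).1 + j) := by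
    intro k l hkl
    induction l, hkl using Nat.le_induction with
    | base => exact fun _ _ => rfl
    | succ l hkl ih =>
      intro j hj
      rw [hst, h2 _ _ j (lt_of_lt_of_le hj (hmono hkl)), ih j hj]
  let v : ℕ → Fin 2 := fun j => w ((st (j + 1)).1 + j)
  have hv : ∀ k, ∀ j < (st k).2, v j = w ((st k).1 + j) := by
    intro k j hj
    rcases Nat.le_total k (j + 1) with h | h
    · exact hcons _ _ h j hj
    · exact (hcons _ _ h j (hge (j + 1))).symm
  have hmem : v ∈ {v : ℕ → Fin 2 | language v ⊆ language w} := by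
    rintro _ ⟨a, b, rfl⟩
    refine ⟨(st (a + b)).1 + a, b, factorAt_eq_iff.2 fun k hk => ?_⟩
    rw [hv (a + b) (a + k) (lt_of_lt_of_le (by omega) (hge (a + b))), Nat.add_assoc]
  rw [hf] at hmem
  obtain ⟨k, hk⟩ := hmem
  obtain ⟨j, hj, hne⟩ := h3 (f k) (st k)
  rw [← hst] at hj hne
  rw [hk, hv (k + 1) j hj] at hne
  exact hne rfl

theorem countable_eventuallyPeriodic : {w : ℕ → Fin 2 | EventuallyPeriodic w}.Countable := by
  have hsub : {w : ℕ → Fin 2 | EventuallyPeriodic w} ⊆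
      ⋃ (N : ℕ) (d : ℕ), {w | 0 < d ∧ ∀ i, N ≤ i → w (i + d) = w i} := by
    rintro w ⟨N, d, h⟩
    simp only [Set.mem_iUnion]
    exact ⟨N, d, h⟩
  refine Set.Countable.mono hsub (Set.countable_iUnion fun N => Set.countable_iUnion fun d => ?_)
  refine Set.MapsTo.countable_of_injOn (f := fun w => factorAt w 0 (N + d))
    (Set.mapsTo_univ _ _) ?_ (Set.to_countable _)
  rintro w ⟨hd, hw⟩ w' ⟨-, hw'⟩ heq
  funext i
  induction i using Nat.strong_induction_on with
  | _ i ih =>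
    rcases Nat.lt_or_ge i (N + d) with hi | hi
    · simpa using factorAt_eq_iff.1 heq i hi
    · have e1 := hw (i - d) (by omega)
      have e2 := hw' (i - d) (by omega)
      rw [Nat.sub_add_cancel (by omega)] at e1 e2
      rw [e1, e2, ih _ (by omega)]

theorem countable_cons_pair (w : ℕ → Fin 2) :
    {w' : ℕ → Fin 2 | ∃ c, ({w, w'} : Set (ℕ → Fin 2)) = {cons 0 c, cons 1 c}}.Countable := by
  refine (Set.to_countable {cons 0 fun i => w (i + 1), cons 1 fun i => w (i + 1)}).mono ?_
  rintro w' ⟨c, h⟩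
  have hw : w ∈ ({cons 0 c, cons 1 c} : Set (ℕ → Fin 2)) := h ▸ Set.mem_insert _ _
  have hw' : w' ∈ ({cons 0 c, cons 1 c} : Set (ℕ → Fin 2)) := h ▸ Set.mem_insert_of_mem _ rfl
  -- The word `c` must be the tail of `w`, leaving two candidates for `w'`.
  have hc : (fun i => w (i + 1)) = c := by
    rcases hw with rfl | rfl <;> rfl
  rwa [hc]

theorem IsSturmian.not_countable_isRCFactorization {w : ℕ → Fin 2} (hw : IsSturmian w) :
    ¬ {x : ℕ → List (Fin 2) | IsRCFactorization w x}.Countable := by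
  intro hcount
  set A : Set (ℕ → Fin 2) := {w' | ∃ x, IsRCDeterminedBy w w' x} with hA
  have hAc : A.Countable := by
    choose! g hg using fun (w' : ℕ → Fin 2) (h : w' ∈ A) => h
    refine Set.MapsTo.countable_of_injOn (f := g)
      (t := {x | IsRCFactorization w x}) (fun w' h => ⟨w', hg w' h⟩) ?_ hcount
    intro w₁ h₁ w₂ h₂ heq
    have e₁ := (hg w₁ h₁).2.2.2
    rw [heq] at e₁
    exact e₁.unique (hg w₂ h₂).2.2.2
  refine hw.not_countable_language_subset
    (((hAc.union countable_eventuallyPeriodic).union (countable_cons_pair w)).mono ?_)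
  intro w' hsub
  by_cases hp : EventuallyPeriodic w'
  · exact Or.inl (Or.inr hp)
  obtain ⟨hs, hL⟩ := isSturmian_of_language_subset hw hp hsub
  by_cases hc : ∃ c, ({w, w'} : Set (ℕ → Fin 2)) = {cons 0 c, cons 1 c}
  · exact Or.inr hc
  · refine Or.inl (Or.inl (exists_isRCDeterminedBy hw hs hL ?_))
    rintro ⟨c, -, -, h⟩
    exact hc ⟨c, h⟩

end Sturm

theorem mainTheorem8 (w : ℕ → Fin 2) (hw : Sturm.IsSturmian w) :
    ¬ {x : ℕ → List (Fin 2) | Sturm.IsRCFactorization w x}.Countable ∧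
    (∀ w' : ℕ → Fin 2, Sturm.IsSturmian w' → Sturm.language w' = Sturm.language w →
      (¬ ∃ c : ℕ → Fin 2, Sturm.IsCharacteristic c ∧ Sturm.language c = Sturm.language w ∧
        ({w, w'} : Set (ℕ → Fin 2)) = {Sturm.cons 0 c, Sturm.cons 1 c}) →
      ∃! x : ℕ → List (Fin 2), Sturm.IsRCDeterminedBy w w' x) ∧
    (∀ (w₁ w₂ : ℕ → Fin 2) (x₁ x₂ : ℕ → List (Fin 2)),
      Sturm.IsRCDeterminedBy w w₁ x₁ → Sturm.IsRCDeterminedBy w w₂ x₂ → w₁ ≠ w₂ → x₁ ≠ x₂) := by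
  refine ⟨hw.not_countable_isRCFactorization, fun w' hw' hL hex => ?_, ?_⟩
  · obtain ⟨x, hx⟩ := Sturm.exists_isRCDeterminedBy hw hw' hL hex
    exact ⟨x, hx, fun y hy => hy.unique hx⟩
  · rintro w₁ w₂ x _ h₁ h₂ hne rfl
    exact hne (h₁.2.2.2.unique h₂.2.2.2)
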